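/- Let $H\neq\{0\}$ be a complex Hilbert space and let $B(H)$ be the algebra of bounded linear operators on $H$. A \emph{resolution of identity} on a locally compact Hausdorff space $\Omega\neq\emptyset$, acting on $H$, is a map $P$ from the Borel $\sigma$-algebra of $\Omega$ to $B(H)$ such that (i) each $P(\omega)$ is an orthogonal projection, (ii) $P(\Omega)=1$, and (iii) for every $x\in H$, the function $\omega\mapsto\langle P(\omega)x,x\rangle=\|P(\omega)x\|^2$ is a measure that is inner regular, i.e. its value at each Borel set $\omega$ is the supremum of its values at the compact subsets of $\omega$. For a Borel step function $h=\sum_{\omega\in D}\alpha_\omega 1_\omega$ with $D$ a finite Borel partition of $\Omega$, put $I_P(h)=\sum_{\omega\in D}\alpha_\omega P(\omega)$. For a bounded Borel function $f:\Omega\to\mathbb C$ and $a\in B(H)$, one writes $a=\int f\,dP$ (in norm) if $\|a-I_P(h)\|\le\sup_{z\in\Omega}|f(z)-h(z)|$ for every Borel step function $h$. If there is a largest open set $\omega\subset\Omega$ with $P(\omega)=0$, then $\Omega\setminus\omega$ is called the \emph{support} of $P$. For $S\subset B(H)$, let $S'$ denote the set of all operators in $B(H)$ that commute with every element of $S$,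 and put $P'=\{P(\omega):\omega\subset\Omega\text{ Borel}\}'$. \textbf{Theorem (Spectral Theorem for normal bounded linear operators).} Let $b$ be a normal bounded linear operator on $H$, with spectrum $\mathrm{sp}(b)$. Then there is a unique resolution of identity $P$ on $\mathrm{sp}(b)$, acting on $H$, such that $$b=\int_{\mathrm{sp}(b)} z\,dP(z)\quad\text{(in norm)}.$$ Moreover, $\{b\}'=P'$, and the support of $P$ exists and is all of $\mathrm{sp}(b)$. -/

import Mathlib

open MeasureTheory Function

noncomputable section

/-- A spectral measure on the σ-algebra of the measurable space `Ω`, acting on the Hilbert space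
`H`: a projection-valued map `P` on the measurable sets with `P Ω = 1` such that, for every `x`,
`ω ↦ ⟨P ω x, x⟩ = ‖P ω x‖ ^ 2` is a measure.  As for Mathlib's vector measures, the irrelevant
values at non-measurable sets are fixed to be `0`, so that a spectral measure is determined by its
values on the measurable sets. -/
@[ext]
structure SpectralMeasure (Ω : Type*) [MeasurableSpace Ω] (H : Type*) [NormedAddCommGroup H]
    [InnerProductSpace ℂ H] [CompleteSpace H] where
  toFun : Set Ω → H →L[ℂ] H
  not_measurable : ∀ ω, ¬ MeasurableSet ω → toFun ω = 0
  isStarProjection : ∀ ω, MeasurableSet ω → IsStarProjection (toFun ω)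
  univ : toFun Set.univ = 1
  hasSum_iUnion : ∀ (x : H) (ω : ℕ → Set Ω), (∀ i, MeasurableSet (ω i)) →
    Pairwise (Disjoint on ω) →
    HasSum (fun i => ‖toFun (ω i) x‖ ^ 2) (‖toFun (⋃ i, ω i) x‖ ^ 2)

namespace SpectralMeasure

section

variable {Ω : Type*} [MeasurableSpace Ω] {H : Type*} [NormedAddCommGroup H]
  [InnerProductSpace ℂ H] [CompleteSpace H]

instance : CoeFun (SpectralMeasure Ω H) (fun _ => Set Ω → H →L[ℂ] H) := ⟨SpectralMeasure.toFun⟩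

theorem empty (P : SpectralMeasure Ω H) : P ∅ = 0 := by
  ext x
  have h := P.hasSum_iUnion x (fun _ => ∅) (fun _ => MeasurableSet.empty)
    (fun _ _ _ => disjoint_bot_left)
  have h0 := h.summable.tendsto_atTop_zero
  have h1 := tendsto_nhds_unique h0 tendsto_const_nhds
  simpa using h1.symm

theorem inner_apply_self (P : SpectralMeasure Ω H) (ω : Set Ω) (x : H) :
    inner ℂ (P ω x) x = ((‖P ω x‖ ^ 2 : ℝ) : ℂ) := by
  by_cases hω : MeasurableSet ω
  · have h := P.isStarProjection ω hω
    have h1 : P ω (P ω x) = P ω x := congrArg (fun a : H →L[ℂ] H => a x) h.isIdempotentElem.eq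
    have h2 : ContinuousLinearMap.adjoint (P ω) = P ω := h.isSelfAdjoint
    have h3 : inner ℂ (P ω x) (P ω x) = inner ℂ (P ω x) x := by
      conv_lhs => rw [← ContinuousLinearMap.adjoint_inner_left, h2, h1]
    rw [← h3, inner_self_eq_norm_sq_to_K]
    norm_cast
  · simp [P.not_measurable ω hω]

/-- The measure `⟨P x, x⟩ : ω ↦ ⟨P ω x, x⟩ = ‖P ω x‖ ^ 2`. -/
def scalarMeasure (P : SpectralMeasure Ω H) (x : H) : Measure Ω :=
  Measure.ofMeasurable (fun ω _ => ENNReal.ofReal (‖P ω x‖ ^ 2))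
    (by simp [P.empty])
    (fun ω hω hd => by
      have h := P.hasSum_iUnion x ω hω hd
      rw [← h.tsum_eq, ENNReal.ofReal_tsum_of_nonneg (fun _ => by positivity) h.summable])

theorem scalarMeasure_apply (P : SpectralMeasure Ω H) (x : H) {ω : Set Ω}
    (hω : MeasurableSet ω) : P.scalarMeasure x ω = ENNReal.ofReal (‖P ω x‖ ^ 2) :=
  Measure.ofMeasurable_apply ω hω

/-- The set of operators `{P ω : ω measurable}`. -/
def operators (P : SpectralMeasure Ω H) : Set (H →L[ℂ] H) :=
  {a | ∃ ω, MeasurableSet ω ∧ P ω = a}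

/-- The integral `I_P h = ∑ α • P {h = α}` of a step function `h` with respect to `P`. -/
def stepIntegral (P : SpectralMeasure Ω H) (h : SimpleFunc Ω ℂ) : H →L[ℂ] H :=
  ∑ α ∈ h.range, α • P (h ⁻¹' {α})

/-- `a = ∫ f dP` in norm, for a bounded measurable function `f`: one has
`‖a - I_P h‖ ≤ |f - h|_∞` for every step function `h`, where `|·|_∞` is the supremum norm. -/
def IsNormIntegral (P : SpectralMeasure Ω H) (f : Ω → ℂ) (a : H →L[ℂ] H) : Prop :=
  Measurable f ∧ BddAbove (Set.range fun z => ‖f z‖) ∧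
    ∀ h : SimpleFunc Ω ℂ, ‖a - P.stepIntegral h‖ ≤ ⨆ z, ‖f z - h z‖

end

end SpectralMeasure

/-- A resolution of identity on a locally compact Hausdorff space `Ω`, acting on `H`: a spectral
measure on the Borel σ-algebra of `Ω` such that all the measures `⟨P x, x⟩` are inner regular with
respect to compact sets. -/
@[ext]
structure ResolutionOfIdentity (Ω : Type*) [TopologicalSpace Ω] [LocallyCompactSpace Ω]
    [T2Space Ω] [MeasurableSpace Ω] [BorelSpace Ω] (H : Type*) [NormedAddCommGroup H]
    [InnerProductSpace ℂ H] [CompleteSpace H] extends SpectralMeasure Ω H where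
  innerRegular : ∀ x : H, (toSpectralMeasure.scalarMeasure x).InnerRegular

/-- `S` is the support of `P`: there is a largest open set `ω` with `P ω = 0`, and `S` is its
complement. -/
def ResolutionOfIdentity.HasSupport {Ω : Type*} [TopologicalSpace Ω] [LocallyCompactSpace Ω]
    [T2Space Ω] [MeasurableSpace Ω] [BorelSpace Ω] {H : Type*} [NormedAddCommGroup H]
    [InnerProductSpace ℂ H] [CompleteSpace H] (P : ResolutionOfIdentity Ω H) (S : Set Ω) : Prop :=
  ∃ ω : Set Ω, IsGreatest {U : Set Ω | IsOpen U ∧ P.toSpectralMeasure U = 0} ω ∧ S = ωᶜ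

end

open MeasureTheory Function

open scoped InnerProductSpace ComplexConjugate CompactlySupported

noncomputable section

/-! Existence. Let `Φ` be the continuous functional calculus of `b`. For each `x`, the positive
functional `f ↦ ⟨x, Φ f x⟩` is represented by a regular measure `μ_x` (Riesz–Markov–Kakutani). Since
`‖Φ g x‖² = ∫ |g|² dμ_x`, the map `g ↦ Φ g x` extends to an isometry of `L²(μ_x)` into `H`, and `P ω
x` is the image of the indicator of `ω`. Linearity in `x` is not visible from this pointwise
definition; it holds because `P ω` is a pointwise limit of operators `Φ g` (`projFun_mem_closure`).
The same limit shows that `P ω` commutes with everything commuting with the range of `Φ`. The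
isometry turns the norm estimate for the integral into an `L²` estimate.

Uniqueness. If `b = ∫ z dP`, the functions `g` whose uniform integral is `Φ g` form a closed
star-subalgebra containing the constants and `z`, hence are all of `C(sp b)` by Stone–Weierstrass.
So `⟨P x, x⟩` and `μ_x` integrate continuous functions alike, and `P` is the measure constructed
above.

The equality of commutants then rests on Fuglede's theorem, and full support on injectivity of `Φ`
together with Urysohn's lemma. -/

theorem exists_simpleFunc_norm_sub_le {X : Type*} [TopologicalSpace X] [CompactSpace X]
    [MeasurableSpace X] [BorelSpace X] (f : C(X, ℂ)) {ε : ℝ} (hε : 0 < ε) :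
    ∃ h : SimpleFunc X ℂ, ∀ z, ‖f z - h z‖ ≤ ε := by
  have hK := isCompact_range f.continuous
  obtain ⟨t, ht⟩ := hK.elim_finite_subcover
    (fun n : ℕ => Metric.ball (TopologicalSpace.denseSeq ℂ n) ε) (fun n => Metric.isOpen_ball)
    (fun w _ => by
      obtain ⟨n, hn⟩ := (TopologicalSpace.denseRange_denseSeq ℂ).exists_dist_lt w hε
      exact Set.mem_iUnion.2 ⟨n, hn⟩)
  -- `t.sup id` is the largest index in the finite subcover, so every centre of the cover competes
  -- for nearest point.
  refine ⟨(SimpleFunc.nearestPt (TopologicalSpace.denseSeq ℂ) (t.sup id)).comp f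
    f.continuous.measurable, fun z => ?_⟩
  obtain ⟨n, hn, hz⟩ := Set.mem_iUnion₂.1 (ht ⟨z, rfl⟩)
  have h1 := SimpleFunc.edist_nearestPt_le (TopologicalSpace.denseSeq ℂ) (f z)
    (Finset.le_sup (f := id) hn)
  rw [edist_dist, edist_dist, ENNReal.ofReal_le_ofReal_iff dist_nonneg] at h1
  rw [← dist_eq_norm, dist_comm]
  refine h1.trans ?_
  rw [dist_comm]
  exact (Metric.mem_ball.1 hz).le

namespace SpectralMeasure

theorem eq_of_forall_inner_apply_self {H : Type*} [NormedAddCommGroup H] [InnerProductSpace ℂ H]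
    {S T : H →L[ℂ] H} (h : ∀ x, ⟪S x, x⟫_ℂ = ⟪T x, x⟫_ℂ) :
    S = T :=
  ContinuousLinearMap.coe_injective ((ext_inner_map _ _).1 h)

/-! ### Multiplicativity of spectral measures; the step integral as a star-homomorphism -/

section StepIntegral

variable {Ω : Type*} [MeasurableSpace Ω] {H : Type*} [NormedAddCommGroup H]
  [InnerProductSpace ℂ H] [CompleteSpace H]

theorem ext_scalarMeasure {P Q : SpectralMeasure Ω H}
    (h : ∀ x, P.scalarMeasure x = Q.scalarMeasure x) : P = Q := by
  ext1
  funext ω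
  by_cases hω : MeasurableSet ω
  · refine eq_of_forall_inner_apply_self fun x => ?_
    have h1 := congrArg (fun μ : Measure Ω => μ ω) (h x)
    simp only [scalarMeasure_apply _ _ hω] at h1
    rw [ENNReal.ofReal_eq_ofReal_iff (by positivity) (by positivity)] at h1
    rw [inner_apply_self, inner_apply_self, h1]
  · rw [P.not_measurable ω hω, Q.not_measurable ω hω]

instance (P : SpectralMeasure Ω H) (x : H) : IsFiniteMeasure (P.scalarMeasure x) :=
  ⟨by rw [scalarMeasure_apply _ _ MeasurableSet.univ]; exact ENNReal.ofReal_lt_top⟩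

theorem scalarMeasure_real_apply (P : SpectralMeasure Ω H) (x : H) {ω : Set Ω}
    (hω : MeasurableSet ω) : (P.scalarMeasure x).real ω = ‖P ω x‖ ^ 2 := by
  rw [Measure.real, scalarMeasure_apply _ _ hω, ENNReal.toReal_ofReal (by positivity)]

theorem inner_self_apply (P : SpectralMeasure Ω H) {ω : Set Ω} (hω : MeasurableSet ω) (x : H) :
    ⟪x, P ω x⟫_ℂ = (((P.scalarMeasure x).real ω : ℝ) : ℂ) := by
  rw [← inner_conj_symm, inner_apply_self, Complex.conj_ofReal, scalarMeasure_real_apply _ _ hω]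

theorem union (P : SpectralMeasure Ω H) {s t : Set Ω} (hs : MeasurableSet s)
    (ht : MeasurableSet t) (h : Disjoint s t) : P (s ∪ t) = P s + P t := by
  refine eq_of_forall_inner_apply_self fun x => ?_
  have := measureReal_union (μ := P.scalarMeasure x) h ht
  rw [scalarMeasure_real_apply _ _ hs, scalarMeasure_real_apply _ _ ht,
    scalarMeasure_real_apply _ _ (hs.union ht)] at this
  rw [add_apply, inner_add_left, inner_apply_self, inner_apply_self,
    inner_apply_self, this]
  push_cast
  rfl

/-- If `p`, `q` and `p + q` are idempotent, then `pq + qp = 0`. Multiplying by `p` on either side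
gives `pq = -pqp = qp`, so `2pq = 0`. -/
theorem mul_of_disjoint (P : SpectralMeasure Ω H) {s t : Set Ω} (hs : MeasurableSet s)
    (ht : MeasurableSet t) (h : Disjoint s t) : P s * P t = 0 := by
  have h1 := (P.isStarProjection _ (hs.union ht)).isIdempotentElem.eq
  have h2 := (P.isStarProjection _ hs).isIdempotentElem.eq
  have h3 := (P.isStarProjection _ ht).isIdempotentElem.eq
  rw [P.union hs ht h] at h1
  generalize P s = p at *
  generalize P t = q at *
  have h4 : p * q + q * p = 0 := by
    have : (p + q) * (p + q) = p * p + q * q + (p * q + q * p) := by noncomm_ring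
    rw [h1, h2, h3] at this
    exact left_eq_add.1 this
  have h5 : p * q = -(p * q * p) := by
    calc p * q = p * p * q := by rw [h2]
      _ = p * (p * q + q * p) - p * q * p := by noncomm_ring
      _ = _ := by rw [h4]; simp
  have h6 : q * p = -(p * q * p) := by
    calc q * p = q * (p * p) := by rw [h2]
      _ = (p * q + q * p) * p - p * q * p := by noncomm_ring
      _ = _ := by rw [h4]; simp
  rw [h6, ← h5, ← two_smul ℂ] at h4
  exact (smul_eq_zero.1 h4).resolve_left two_ne_zero

theorem mul_inter (P : SpectralMeasure Ω H) {s t : Set Ω} (hs : MeasurableSet s)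
    (ht : MeasurableSet t) : P s * P t = P (s ∩ t) := by
  have h1 : P s = P (s ∩ t) + P (s \ t) := by
    rw [← P.union (hs.inter ht) (hs.diff ht)
      (Set.disjoint_sdiff_right.mono_left Set.inter_subset_right), Set.inter_union_sdiff]
  have h2 : P t = P (s ∩ t) + P (t \ s) := by
    rw [← P.union (hs.inter ht) (ht.diff hs)
      (Set.disjoint_sdiff_right.mono_left Set.inter_subset_left), Set.inter_comm,
      Set.inter_union_sdiff]
  rw [h1, h2, add_mul, mul_add, mul_add, (P.isStarProjection _ (hs.inter ht)).isIdempotentElem.eq,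
    P.mul_of_disjoint (hs.inter ht) (ht.diff hs)
      (Set.disjoint_sdiff_right.mono_left Set.inter_subset_left),
    P.mul_of_disjoint (hs.diff ht) (hs.inter ht)
      (Set.disjoint_sdiff_left.mono_right Set.inter_subset_right),
    P.mul_of_disjoint (hs.diff ht) (ht.diff hs)
      (Set.disjoint_sdiff_left.mono_right Set.sdiff_subset)]
  simp

theorem stepIntegral_eq_setToSimpleFunc (P : SpectralMeasure Ω H) (h : SimpleFunc Ω ℂ) :
    P.stepIntegral h = SimpleFunc.setToSimpleFunc (fun s =>
      ((ContinuousLinearMap.id ℂ ℂ).smulRight (P s)).restrictScalars ℝ) h := rfl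

/-- Makes the additivity of `setToSimpleFunc` available; with the zero measure all its integrability
conditions are trivial. -/
theorem finMeasAdditive_smulRight (P : SpectralMeasure Ω H) :
    FinMeasAdditive (0 : Measure Ω) (fun s =>
      ((ContinuousLinearMap.id ℂ ℂ).smulRight (P s)).restrictScalars ℝ) := by
  intro s t hs ht _ _ hst
  ext1
  simp [P.union hs ht hst]

theorem stepIntegral_add (P : SpectralMeasure Ω H) (h k : SimpleFunc Ω ℂ) :
    P.stepIntegral (h + k) = P.stepIntegral h + P.stepIntegral k :=
  SimpleFunc.setToSimpleFunc_add _ P.finMeasAdditive_smulRight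
    (integrable_zero_measure) (integrable_zero_measure)

theorem stepIntegral_piecewise (P : SpectralMeasure Ω H) {s : Set Ω} (hs : MeasurableSet s)
    (c : ℂ) : P.stepIntegral (SimpleFunc.piecewise s hs (SimpleFunc.const _ c)
      (SimpleFunc.const _ 0)) = c • P s := by
  rw [stepIntegral_eq_setToSimpleFunc, SimpleFunc.setToSimpleFunc_indicator _ _ hs]
  · simp
  · ext1; simp [P.empty]

theorem stepIntegral_const (P : SpectralMeasure Ω H) (c : ℂ) :
    P.stepIntegral (SimpleFunc.const _ c) = c • (1 : H →L[ℂ] H) := by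
  rw [← P.univ, ← P.stepIntegral_piecewise MeasurableSet.univ c]
  simp

theorem stepIntegral_mul (P : SpectralMeasure Ω H) (h k : SimpleFunc Ω ℂ) :
    P.stepIntegral (h * k) = P.stepIntegral h * P.stepIntegral k := by
  classical
  induction h using SimpleFunc.induction with
  | add _ h1 h2 => rw [add_mul, stepIntegral_add, stepIntegral_add, h1, h2, add_mul]
  | @const c s hs =>
    induction k using SimpleFunc.induction with
    | add _ h1 h2 => rw [mul_add, stepIntegral_add, stepIntegral_add, h1, h2, mul_add]
    | @const d t ht =>
      rw [P.stepIntegral_piecewise hs, P.stepIntegral_piecewise ht, smul_mul_smul_comm,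
        P.mul_inter hs ht, ← P.stepIntegral_piecewise (hs.inter ht)]
      congr 1
      ext z
      by_cases hz : z ∈ s <;> by_cases hz' : z ∈ t <;> simp [hz, hz']

theorem stepIntegral_map_conj (P : SpectralMeasure Ω H) (h : SimpleFunc Ω ℂ) :
    P.stepIntegral (h.map conj) = star (P.stepIntegral h) := by
  classical
  induction h using SimpleFunc.induction with
  | @add f g _ h1 h2 =>
    rw [stepIntegral_add, star_add, ← h1, ← h2, ← stepIntegral_add]
    congr 1
    ext z
    simp
  | @const c s hs =>
    rw [P.stepIntegral_piecewise hs, star_smul, (P.isStarProjection s hs).isSelfAdjoint.star_eq,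
      ← P.stepIntegral_piecewise hs]
    congr 1
    ext z
    by_cases hz : z ∈ s <;> simp [hz]

theorem inner_stepIntegral (P : SpectralMeasure Ω H) (h : SimpleFunc Ω ℂ) (x : H) :
    ⟪x, P.stepIntegral h x⟫_ℂ = ∫ z, h z ∂P.scalarMeasure x := by
  classical
  induction h using SimpleFunc.induction with
  | @add f g _ h1 h2 =>
    rw [stepIntegral_add, add_apply, inner_add_right, h1, h2,
      ← integral_add (SimpleFunc.integrable_of_isFiniteMeasure _)
        (SimpleFunc.integrable_of_isFiniteMeasure _)]
    rfl
  | @const c s hs =>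
    rw [P.stepIntegral_piecewise hs, smul_apply, inner_smul_right,
      P.inner_self_apply hs]
    have : (fun z => (SimpleFunc.piecewise s hs (SimpleFunc.const _ c)
        (SimpleFunc.const _ 0) : SimpleFunc Ω ℂ) z) = s.indicator (fun _ => c) := by
      ext z; simp [Set.indicator, Set.piecewise]
    rw [this, integral_indicator hs, setIntegral_const, mul_comm]
    simp

end StepIntegral

/-! ### The spectral measure of a representation of `C(X, ℂ)` -/

section Construction

variable {H : Type*} [NormedAddCommGroup H] [InnerProductSpace ℂ H] [CompleteSpace H]
  {X : Type*} [TopologicalSpace X]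

/-- The complex-valued continuous function attached to a real-valued one. -/
def toComplex : C(X, ℝ) →L[ℝ] C(X, ℂ) := Complex.ofRealCLM.compLeftContinuous ℝ X

@[simp]
theorem toComplex_apply (f : C(X, ℝ)) (z : X) : toComplex f z = (f z : ℂ) := rfl

theorem inner_map_star_mul_self (Φ : C(X, ℂ) →⋆ₐ[ℂ] (H →L[ℂ] H)) (g : C(X, ℂ)) (x : H) :
    ⟪x, Φ (star g * g) x⟫_ℂ = ((‖Φ g x‖ ^ 2 : ℝ) : ℂ) := by
  rw [map_mul, map_star, mul_apply_eq_comp, ContinuousLinearMap.star_eq_adjoint,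
    ContinuousLinearMap.adjoint_inner_right, inner_self_eq_norm_sq_to_K]
  norm_cast

variable [CompactSpace X]

/-- The positive functional `f ↦ ⟨Φ f x, x⟩` on real functions. -/
def positiveFunctional (Φ : C(X, ℂ) →⋆ₐ[ℂ] (H →L[ℂ] H)) (x : H) : C_c(X, ℝ) →ₚ[ℝ] ℝ :=
  PositiveLinearMap.mk₀
    { toFun := fun f => (⟪x, Φ (toComplex f.toContinuousMap) x⟫_ℂ).re
      map_add' := fun f g => by
        have : (f + g).toContinuousMap = f.toContinuousMap + g.toContinuousMap := rfl
        rw [this, map_add, map_add, add_apply, inner_add_right, Complex.add_re]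
      map_smul' := fun c f => by
        have : toComplex (c • f).toContinuousMap = (c : ℂ) • toComplex f.toContinuousMap := by
          ext z; simp
        rw [this, map_smul, smul_apply, inner_smul_right, Complex.re_ofReal_mul]
        rfl }
    (fun f hf => by
      have h1 : toComplex f.toContinuousMap =
          star (toComplex ⟨fun z => √(f z), by fun_prop⟩) *
            toComplex ⟨fun z => √(f z), by fun_prop⟩ := by
        ext z
        have : (f z : ℂ) = ((√(f z) * √(f z) : ℝ) : ℂ) := by rw [Real.mul_self_sqrt (hf z)]
        simpa using this
      change 0 ≤ (⟪x, Φ (toComplex f.toContinuousMap) x⟫_ℂ).re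
      rw [h1, inner_map_star_mul_self, Complex.ofReal_re]
      positivity)

variable [T2Space X] [MeasurableSpace X] [BorelSpace X]

/-- The measure representing the functional `f ↦ ⟨Φ f x, x⟩`. -/
def representingMeasure (Φ : C(X, ℂ) →⋆ₐ[ℂ] (H →L[ℂ] H)) (x : H) : Measure X :=
  RealRMK.rieszMeasure (positiveFunctional Φ x)

instance (Φ : C(X, ℂ) →⋆ₐ[ℂ] (H →L[ℂ] H)) (x : H) : (representingMeasure Φ x).Regular :=
  RealRMK.regular_rieszMeasure _

instance (Φ : C(X, ℂ) →⋆ₐ[ℂ] (H →L[ℂ] H)) (x : H) : IsFiniteMeasure (representingMeasure Φ x) :=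
  inferInstanceAs (IsFiniteMeasure (RealRMK.rieszMeasure _))

theorem integral_norm_sq_representingMeasure (Φ : C(X, ℂ) →⋆ₐ[ℂ] (H →L[ℂ] H)) (x : H)
    (g : C(X, ℂ)) : ∫ z, ‖g z‖ ^ 2 ∂representingMeasure Φ x = ‖Φ g x‖ ^ 2 := by
  let f : C_c(X, ℝ) := ⟨⟨fun z => ‖g z‖ ^ 2, by fun_prop⟩, HasCompactSupport.of_compactSpace _⟩
  have h1 : toComplex f.toContinuousMap = star g * g := by
    ext z; simp [f, Complex.conj_mul']
  refine (RealRMK.integral_rieszMeasure (positiveFunctional Φ x) f).trans ?_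
  change (⟪x, Φ (toComplex f.toContinuousMap) x⟫_ℂ).re = _
  rw [h1, inner_map_star_mul_self, Complex.ofReal_re]

theorem norm_toLp_representingMeasure (Φ : C(X, ℂ) →⋆ₐ[ℂ] (H →L[ℂ] H)) (x : H) (g : C(X, ℂ)) :
    ‖ContinuousMap.toLp 2 (representingMeasure Φ x) ℂ g‖ = ‖Φ g x‖ := by
  rw [← sq_eq_sq₀ (norm_nonneg _) (norm_nonneg _), ← integral_norm_sq_representingMeasure]
  apply Complex.ofReal_injective
  have := inner_self_eq_norm_sq_to_K (𝕜 := ℂ) (ContinuousMap.toLp 2 (representingMeasure Φ x) ℂ g)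
  rw [ContinuousMap.inner_toLp] at this
  push_cast
  refine this.symm.trans ?_
  rw [← integral_complex_ofReal]
  congr 1
  ext z
  simp [Complex.mul_conj']

/-- The orbit map `g ↦ Φ g x`. -/
def orbitMap (Φ : C(X, ℂ) →⋆ₐ[ℂ] (H →L[ℂ] H)) (x : H) : C(X, ℂ) →ₗ[ℂ] H :=
  (ContinuousLinearMap.apply ℂ H x).toLinearMap ∘ₗ Φ.toAlgHom.toLinearMap

/-- The extension of the orbit map `g ↦ Φ g x` to `L²`. -/
def cyclicMap (Φ : C(X, ℂ) →⋆ₐ[ℂ] (H →L[ℂ] H)) (x : H) :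
    Lp ℂ 2 (representingMeasure Φ x) →L[ℂ] H :=
  (orbitMap Φ x).extendOfNorm (ContinuousMap.toLp 2 (representingMeasure Φ x) ℂ).toLinearMap

theorem cyclicMap_toLp (Φ : C(X, ℂ) →⋆ₐ[ℂ] (H →L[ℂ] H)) (x : H) (g : C(X, ℂ)) :
    cyclicMap Φ x (ContinuousMap.toLp 2 (representingMeasure Φ x) ℂ g) = Φ g x :=
  LinearMap.extendOfNorm_eq (f := orbitMap Φ x)
    (e := (ContinuousMap.toLp 2 (representingMeasure Φ x) ℂ).toLinearMap)
    (ContinuousMap.toLp_denseRange ℂ _ ℂ ENNReal.ofNat_ne_top)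
    ⟨1, fun g => by rw [one_mul]; exact (norm_toLp_representingMeasure Φ x g).ge⟩ g

/-- The isometry from `L²` onto the cyclic subspace generated by `x`, which extends
`g ↦ Φ g x`. -/
def cyclicIsometry (Φ : C(X, ℂ) →⋆ₐ[ℂ] (H →L[ℂ] H)) (x : H) :
    Lp ℂ 2 (representingMeasure Φ x) →ₗᵢ[ℂ] H where
  toLinearMap := (cyclicMap Φ x).toLinearMap
  norm_map' v := by
    refine (ContinuousMap.toLp_denseRange (p := 2) ℂ (representingMeasure Φ x) ℂ
      ENNReal.ofNat_ne_top).induction_on (p := fun v => ‖cyclicMap Φ x v‖ = ‖v‖) v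
      (isClosed_eq (by fun_prop) (by fun_prop)) fun g => ?_
    rw [cyclicMap_toLp, norm_toLp_representingMeasure]

theorem cyclicIsometry_toLp (Φ : C(X, ℂ) →⋆ₐ[ℂ] (H →L[ℂ] H)) (x : H) (g : C(X, ℂ)) :
    cyclicIsometry Φ x (ContinuousMap.toLp 2 (representingMeasure Φ x) ℂ g) = Φ g x :=
  cyclicMap_toLp Φ x g

/-- The function `x ↦ P ω x` for the spectral measure `P` of `Φ`. -/
def projFun (Φ : C(X, ℂ) →⋆ₐ[ℂ] (H →L[ℂ] H)) {ω : Set X} (hω : MeasurableSet ω) (x : H) : H :=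
  cyclicIsometry Φ x (indicatorConstLp 2 hω (measure_ne_top _ _) 1)

theorem inner_projFun (Φ : C(X, ℂ) →⋆ₐ[ℂ] (H →L[ℂ] H)) {s t : Set X} (hs : MeasurableSet s)
    (ht : MeasurableSet t) (x : H) : ⟪projFun Φ hs x, projFun Φ ht x⟫_ℂ =
      (((representingMeasure Φ x).real (s ∩ t) : ℝ) : ℂ) := by
  rw [projFun, projFun, LinearIsometry.inner_map_map,
    L2.inner_indicatorConstLp_one_indicatorConstLp_one]
  rfl

theorem norm_projFun_sq (Φ : C(X, ℂ) →⋆ₐ[ℂ] (H →L[ℂ] H)) {ω : Set X} (hω : MeasurableSet ω)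
    (x : H) : ‖projFun Φ hω x‖ ^ 2 = (representingMeasure Φ x).real ω := by
  have := inner_projFun Φ hω hω x
  rw [inner_self_eq_norm_sq_to_K, Set.inter_self] at this
  apply Complex.ofReal_injective
  rw [← this, Complex.ofReal_pow]
  rfl

theorem projFun_univ (Φ : C(X, ℂ) →⋆ₐ[ℂ] (H →L[ℂ] H)) (x : H) :
    projFun Φ MeasurableSet.univ x = x := by
  have : indicatorConstLp 2 MeasurableSet.univ (measure_ne_top (representingMeasure Φ x) _) (1 : ℂ)
      = ContinuousMap.toLp 2 _ ℂ (1 : C(X, ℂ)) := by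
    ext1
    refine indicatorConstLp_coeFn.trans (.trans ?_ (ContinuousMap.coeFn_toLp _ _).symm)
    exact .of_forall fun z => by simp
  rw [projFun, this, cyclicIsometry_toLp, map_one, one_apply_eq_self]

variable [TopologicalSpace.PseudoMetrizableSpace X]

/-- One `g` serves all `x ∈ s`: approximate the indicator in `L²` of the sum of the measures, which
dominates each of them. -/
theorem exists_norm_projFun_sub_le (Φ : C(X, ℂ) →⋆ₐ[ℂ] (H →L[ℂ] H)) {ω : Set X}
    (hω : MeasurableSet ω) (s : Finset H) {ε : ℝ} (hε : 0 < ε) :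
    ∃ g : C(X, ℂ), ∀ x ∈ s, ‖projFun Φ hω x - Φ g x‖ ≤ ε := by
  have hm : MemLp (ω.indicator fun _ => (1 : ℂ)) 2 (∑ x ∈ s, representingMeasure Φ x) :=
    memLp_indicator_const 2 hω 1 (Or.inr (measure_ne_top _ _))
  obtain ⟨g, hg, -⟩ := hm.exists_boundedContinuous_eLpNorm_sub_le ENNReal.ofNat_ne_top
    (ENNReal.ofReal_pos.2 hε).ne'
  refine ⟨g.toContinuousMap, fun x hx => ?_⟩
  have hle : representingMeasure Φ x ≤ ∑ x ∈ s, representingMeasure Φ x :=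
    Finset.single_le_sum (f := representingMeasure Φ) (fun _ _ => Measure.zero_le _) hx
  rw [projFun, ← cyclicIsometry_toLp, ← map_sub, LinearIsometry.norm_map, Lp.norm_def]
  refine ENNReal.toReal_le_of_le_ofReal hε.le (le_trans ?_ hg)
  refine (eLpNorm_congr_ae ?_).trans_le (eLpNorm_mono_measure _ hle)
  exact (Lp.coeFn_sub _ _).trans (indicatorConstLp_coeFn.sub (ContinuousMap.coeFn_toLp _ _))

theorem projFun_mem_closure (Φ : C(X, ℂ) →⋆ₐ[ℂ] (H →L[ℂ] H)) {ω : Set X}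
    (hω : MeasurableSet ω) :
    projFun Φ hω ∈ closure (Set.range fun g : C(X, ℂ) => (Φ g : H → H)) := by
  refine mem_closure_iff.2 fun o ho hmem => ?_
  obtain ⟨I, u, hu, hIu⟩ := isOpen_pi_iff.1 ho _ hmem
  have h1 : ∀ᶠ ε in nhdsWithin (0 : ℝ) (Set.Ioi 0), ∀ x ∈ I,
      Metric.closedBall (projFun Φ hω x) ε ⊆ u x := by
    refine (Filter.eventually_all_finset I).2 fun x hx => ?_
    obtain ⟨ε, hε, hs⟩ := Metric.nhds_basis_closedBall.mem_iff.1
      ((hu x hx).1.mem_nhds (hu x hx).2)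
    filter_upwards [Ioc_mem_nhdsGT hε] with δ hδ
    exact (Metric.closedBall_subset_closedBall hδ.2).trans hs
  obtain ⟨ε, hεI, hε⟩ := (h1.and self_mem_nhdsWithin).exists
  obtain ⟨g, hg⟩ := exists_norm_projFun_sub_le Φ hω I hε
  exact ⟨Φ g, hIu fun x hx => hεI x hx (mem_closedBall_iff_norm'.2 (hg x hx)), g, rfl⟩

/-- The projection `P ω` for the spectral measure `P` of `Φ`. -/
def proj (Φ : C(X, ℂ) →⋆ₐ[ℂ] (H →L[ℂ] H)) {ω : Set X} (hω : MeasurableSet ω) : H →L[ℂ] H :=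
  -- A pointwise limit of linear maps is linear.
  (linearMapOfMemClosureRangeCoe (σ := RingHom.id ℂ) (projFun Φ hω) (closure_mono (by
    rintro _ ⟨g, rfl⟩
    exact ⟨(Φ g).toLinearMap, rfl⟩) (projFun_mem_closure Φ hω))).mkContinuous 1 fun x => by
      rw [one_mul, ← sq_le_sq₀ (norm_nonneg _) (norm_nonneg _)]
      change ‖projFun Φ hω x‖ ^ 2 ≤ _
      nth_rw 2 [← projFun_univ Φ x]
      rw [norm_projFun_sq, norm_projFun_sq]
      exact measureReal_mono (Set.subset_univ _)

theorem proj_apply (Φ : C(X, ℂ) →⋆ₐ[ℂ] (H →L[ℂ] H)) {ω : Set X} (hω : MeasurableSet ω) (x : H) :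
    proj Φ hω x = projFun Φ hω x := rfl

theorem commute_proj (Φ : C(X, ℂ) →⋆ₐ[ℂ] (H →L[ℂ] H)) {ω : Set X} (hω : MeasurableSet ω)
    {a : H →L[ℂ] H} (ha : ∀ g, Commute (Φ g) a) : Commute (proj Φ hω) a := by
  ext x
  have hc : IsClosed {f : H → H | f (a x) = a (f x)} := isClosed_eq (by fun_prop) (by fun_prop)
  refine closure_minimal ?_ hc (projFun_mem_closure Φ hω)
  rintro _ ⟨g, rfl⟩
  exact congrArg (fun T : H →L[ℂ] H => T x) (ha g).eq

/-- The hypothesis says that `T* T` and `T` have the same quadratic form, so `T = T* T`, which is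
self-adjoint. -/
theorem isStarProjection_of_inner {T : H →L[ℂ] H}
    (h : ∀ x, ⟪T x, x⟫_ℂ = ((‖T x‖ ^ 2 : ℝ) : ℂ)) : IsStarProjection T := by
  have h1 : star T * T = T := eq_of_forall_inner_apply_self fun x => by
    rw [h, mul_apply_eq_comp, ContinuousLinearMap.star_eq_adjoint,
      ContinuousLinearMap.adjoint_inner_left, inner_self_eq_norm_sq_to_K]
    norm_cast
  have h2 : star T = T := by rw [← h1, star_mul, star_star]
  exact ⟨by rwa [h2] at h1, h2⟩

theorem isStarProjection_proj (Φ : C(X, ℂ) →⋆ₐ[ℂ] (H →L[ℂ] H)) {ω : Set X}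
    (hω : MeasurableSet ω) : IsStarProjection (proj Φ hω) := by
  refine isStarProjection_of_inner fun x => ?_
  rw [proj_apply, norm_projFun_sq]
  nth_rw 2 [← projFun_univ Φ x]
  rw [inner_projFun, Set.inter_univ]

open scoped Classical in
/-- The spectral measure of a representation `Φ` of `C(X, ℂ)` on `H`. -/
def ofStarAlgHom (Φ : C(X, ℂ) →⋆ₐ[ℂ] (H →L[ℂ] H)) : SpectralMeasure X H where
  toFun ω := if hω : MeasurableSet ω then proj Φ hω else 0
  not_measurable ω hω := dif_neg hω
  isStarProjection ω hω := by rw [dif_pos hω]; exact isStarProjection_proj Φ hω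
  univ := by
    rw [dif_pos MeasurableSet.univ]
    ext x
    exact projFun_univ Φ x
  hasSum_iUnion x ω hω hd := by
    simp only [dif_pos (hω _), dif_pos (MeasurableSet.iUnion hω), proj_apply, norm_projFun_sq]
    have h1 := measure_iUnion (μ := representingMeasure Φ x) hd hω
    have h2 : ∑' i, representingMeasure Φ x (ω i) ≠ ⊤ := h1 ▸ measure_ne_top _ _
    rw [Measure.real, h1, ENNReal.tsum_toReal_eq fun i => measure_ne_top _ _]
    exact ENNReal.hasSum_toReal h2

theorem ofStarAlgHom_apply (Φ : C(X, ℂ) →⋆ₐ[ℂ] (H →L[ℂ] H)) {ω : Set X} (hω : MeasurableSet ω) :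
    ofStarAlgHom Φ ω = proj Φ hω := dif_pos hω

theorem scalarMeasure_ofStarAlgHom (Φ : C(X, ℂ) →⋆ₐ[ℂ] (H →L[ℂ] H)) (x : H) :
    (ofStarAlgHom Φ).scalarMeasure x = representingMeasure Φ x := by
  ext ω hω
  rw [scalarMeasure_apply _ _ hω, ofStarAlgHom_apply Φ hω, proj_apply, norm_projFun_sq,
    ofReal_measureReal]

theorem stepIntegral_ofStarAlgHom_apply (Φ : C(X, ℂ) →⋆ₐ[ℂ] (H →L[ℂ] H)) (h : SimpleFunc X ℂ)
    (x : H) : (ofStarAlgHom Φ).stepIntegral h x = cyclicIsometry Φ x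
      ((h.memLp_of_isFiniteMeasure 2 (representingMeasure Φ x)).toLp h) := by
  classical
  induction h using SimpleFunc.induction with
  | @add f g _ h1 h2 =>
    rw [stepIntegral_add, add_apply, h1, h2, ← map_add, ← MemLp.toLp_add]
    rfl
  | @const c s hs =>
    rw [stepIntegral_piecewise _ hs, smul_apply, ofStarAlgHom_apply Φ hs, proj_apply, projFun,
      ← map_smul, indicatorConstLp, ← MemLp.toLp_const_smul]
    congr 1
    refine MemLp.toLp_congr _ _ (.of_forall fun z => ?_)
    by_cases hz : z ∈ s <;> simp [hz]

theorem norm_sub_stepIntegral_ofStarAlgHom_le (Φ : C(X, ℂ) →⋆ₐ[ℂ] (H →L[ℂ] H)) (g : C(X, ℂ))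
    (h : SimpleFunc X ℂ) {C : ℝ} (hC : 0 ≤ C) (hgh : ∀ z, ‖g z - h z‖ ≤ C) :
    ‖Φ g - (ofStarAlgHom Φ).stepIntegral h‖ ≤ C := by
  refine ContinuousLinearMap.opNorm_le_bound _ hC fun x => ?_
  rw [sub_apply, stepIntegral_ofStarAlgHom_apply, ← cyclicIsometry_toLp, ← map_sub,
    LinearIsometry.norm_map]
  refine (Lp.norm_le_of_ae_bound hC ?_).trans_eq ?_
  · filter_upwards [Lp.coeFn_sub (ContinuousMap.toLp 2 (representingMeasure Φ x) ℂ g)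
      ((h.memLp_of_isFiniteMeasure 2 (representingMeasure Φ x)).toLp h),
      ContinuousMap.coeFn_toLp (p := 2) (𝕜 := ℂ) (representingMeasure Φ x) g,
      (h.memLp_of_isFiniteMeasure 2 (representingMeasure Φ x)).coeFn_toLp] with z h1 h2 h3
    rw [h1, Pi.sub_apply, h2, h3]
    exact hgh z
  -- The total mass of `μ_x` is `‖x‖²`, so its square root supplies the factor `‖x‖`.
  · have := norm_projFun_sq Φ MeasurableSet.univ x
    rw [projFun_univ] at this
    have h2 : ((measureUnivNNReal (representingMeasure Φ x) : NNReal) : ℝ) = ‖x‖ ^ 2 := this.symm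
    rw [h2, mul_comm, ENNReal.toReal_ofNat, ← Real.rpow_natCast, ← Real.rpow_mul (norm_nonneg _)]
    norm_num

end Construction

/-! ### Uniform limits of step integrals -/

section Approx

variable {Ω : Type*} [MeasurableSpace Ω] {H : Type*} [NormedAddCommGroup H]
  [InnerProductSpace ℂ H] [CompleteSpace H]

/-- `a` is the limit of the integrals of step functions converging uniformly to `f`. -/
def IsUniformIntegral (P : SpectralMeasure Ω H) (f : Ω → ℂ) (a : H →L[ℂ] H) : Prop :=
  ∀ ε > 0, ∃ h : SimpleFunc Ω ℂ, (∀ z, ‖f z - h z‖ ≤ ε) ∧ ‖a - P.stepIntegral h‖ ≤ ε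

variable {P : SpectralMeasure Ω H} {f g : Ω → ℂ} {a b : H →L[ℂ] H}

theorem IsUniformIntegral.const (P : SpectralMeasure Ω H) (c : ℂ) :
    P.IsUniformIntegral (fun _ => c) (c • 1) := fun ε hε =>
  ⟨SimpleFunc.const _ c, by simp [hε.le], by simp [stepIntegral_const, hε.le]⟩

theorem IsUniformIntegral.conj (hf : P.IsUniformIntegral f a) :
    P.IsUniformIntegral (fun z => conj (f z)) (star a) := fun ε hε => by
  obtain ⟨h, h1, h2⟩ := hf ε hε
  refine ⟨h.map conj, fun z => ?_, ?_⟩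
  · rw [SimpleFunc.map_apply, ← map_sub, RCLike.norm_conj]
    exact h1 z
  · rwa [stepIntegral_map_conj, ← star_sub, norm_star]

theorem IsUniformIntegral.add (hf : P.IsUniformIntegral f a) (hg : P.IsUniformIntegral g b) :
    P.IsUniformIntegral (fun z => f z + g z) (a + b) := fun ε hε => by
  obtain ⟨h, h1, h2⟩ := hf (ε / 2) (half_pos hε)
  obtain ⟨k, k1, k2⟩ := hg (ε / 2) (half_pos hε)
  refine ⟨h + k, fun z => ?_, ?_⟩
  · rw [SimpleFunc.coe_add, Pi.add_apply, add_sub_add_comm, ← add_halves ε]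
    exact norm_add_le_of_le (h1 z) (k1 z)
  · rw [stepIntegral_add, add_sub_add_comm, ← add_halves ε]
    exact norm_add_le_of_le h2 k2

theorem norm_mul_sub_mul_le {A : Type*} [NormedRing A] {x y x' y' : A} {C δ : ℝ}
    (hx : ‖x‖ ≤ C) (hy : ‖y‖ ≤ C) (hδ : δ ≤ 1) (hx' : ‖x - x'‖ ≤ δ) (hy' : ‖y - y'‖ ≤ δ) :
    ‖x * y - x' * y'‖ ≤ δ * (2 * C + 1) := by
  have hδ0 : 0 ≤ δ := (norm_nonneg _).trans hx'
  have h1 : ‖y'‖ ≤ C + 1 := by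
    have := norm_sub_le y (y - y')
    rw [sub_sub_cancel] at this
    linarith
  calc ‖x * y - x' * y'‖ = ‖x * (y - y') + (x - x') * y'‖ := by congr 1; noncomm_ring
    _ ≤ ‖x‖ * ‖y - y'‖ + ‖x - x'‖ * ‖y'‖ :=
      norm_add_le_of_le (norm_mul_le _ _) (norm_mul_le _ _)
    _ ≤ C * δ + δ * (C + 1) := by
      gcongr
      exact (norm_nonneg _).trans hx
    _ = _ := by ring

theorem IsUniformIntegral.mul (hf : P.IsUniformIntegral f a) (hg : P.IsUniformIntegral g b)
    {K : ℝ} (hfK : ∀ z, ‖f z‖ ≤ K) (hgK : ∀ z, ‖g z‖ ≤ K) :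
    P.IsUniformIntegral (fun z => f z * g z) (a * b) := fun ε hε => by
  -- `C` bounds both the functions and the operators, so the same product estimate applies in `ℂ`
  -- and in `B(H)`.
  set C := max K (max ‖a‖ ‖b‖)
  have hC : 0 ≤ C := (norm_nonneg a).trans ((le_max_left _ _).trans (le_max_right _ _))
  set δ := min 1 (ε / (2 * C + 1))
  have hδ : 0 < δ := lt_min one_pos (by positivity)
  have hδε : δ * (2 * C + 1) ≤ ε := by
    rw [← le_div_iff₀ (by positivity)]
    exact min_le_right _ _
  obtain ⟨h, h1, h2⟩ := hf δ hδ
  obtain ⟨k, k1, k2⟩ := hg δ hδ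
  refine ⟨h * k, fun z => ?_, ?_⟩
  · exact (norm_mul_sub_mul_le ((hfK z).trans (le_max_left _ _))
      ((hgK z).trans (le_max_left _ _)) (min_le_left _ _) (h1 z) (k1 z)).trans hδε
  · rw [stepIntegral_mul]
    exact (norm_mul_sub_mul_le ((le_max_left _ _).trans (le_max_right _ _))
      ((le_max_right _ _).trans (le_max_right _ _)) (min_le_left _ _) h2 k2).trans hδε

theorem IsUniformIntegral.of_approx
    (h : ∀ ε > 0, ∃ g b, P.IsUniformIntegral g b ∧ (∀ z, ‖f z - g z‖ ≤ ε) ∧ ‖a - b‖ ≤ ε) :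
    P.IsUniformIntegral f a := fun ε hε => by
  obtain ⟨g, b, hg, h1, h2⟩ := h (ε / 2) (half_pos hε)
  obtain ⟨k, k1, k2⟩ := hg (ε / 2) (half_pos hε)
  refine ⟨k, fun z => ?_, ?_⟩
  · rw [← sub_add_sub_cancel _ (g z), ← add_halves ε]
    exact norm_add_le_of_le (h1 z) (k1 z)
  · rw [← sub_add_sub_cancel _ b, ← add_halves ε]
    exact norm_add_le_of_le h2 k2

theorem IsUniformIntegral.inner_apply (hf : P.IsUniformIntegral f a) (x : H)
    (hfi : Integrable f (P.scalarMeasure x)) :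
    ⟪x, a x⟫_ℂ = ∫ z, f z ∂P.scalarMeasure x := by
  have key : ∀ ε > 0, ‖⟪x, a x⟫_ℂ - ∫ z, f z ∂P.scalarMeasure x‖ ≤ ε * (2 * ‖x‖ ^ 2) := by
    intro ε hε
    obtain ⟨h, h1, h2⟩ := hf ε hε
    have e1 : ‖⟪x, (a - P.stepIntegral h) x⟫_ℂ‖ ≤ ε * ‖x‖ ^ 2 := by
      calc _ ≤ ‖x‖ * ‖(a - P.stepIntegral h) x‖ := norm_inner_le_norm _ _
        _ ≤ ‖x‖ * (ε * ‖x‖) := by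
          gcongr
          exact ContinuousLinearMap.le_of_opNorm_le _ h2 x
        _ = _ := by ring
    have e2 : ‖∫ z, (f z - h z) ∂P.scalarMeasure x‖ ≤ ε * ‖x‖ ^ 2 := by
      refine (norm_integral_le_of_norm_le_const (.of_forall h1)).trans_eq ?_
      rw [scalarMeasure_real_apply _ _ MeasurableSet.univ, P.univ]
      rfl
    rw [integral_sub hfi (SimpleFunc.integrable_of_isFiniteMeasure h),
      ← inner_stepIntegral] at e2
    rw [sub_apply, inner_sub_right] at e1
    calc _ = ‖(⟪x, a x⟫_ℂ - ⟪x, P.stepIntegral h x⟫_ℂ) -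
          ((∫ z, f z ∂P.scalarMeasure x) - ⟪x, P.stepIntegral h x⟫_ℂ)‖ := by
            rw [sub_sub_sub_cancel_right]
      _ ≤ ε * ‖x‖ ^ 2 + ε * ‖x‖ ^ 2 := norm_sub_le_of_le e1 e2
      _ = _ := by ring
  rw [← sub_eq_zero, ← norm_le_zero_iff]
  refine le_of_forall_pos_le_add fun ε hε => ?_
  -- The `+ 1` keeps the denominator positive when `x = 0`.
  refine (key (ε / (2 * ‖x‖ ^ 2 + 1)) (by positivity)).trans ?_
  rw [zero_add, div_mul_eq_mul_div, div_le_iff₀ (by positivity)]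
  gcongr
  linarith

theorem IsUniformIntegral.mem_centralizer (hf : P.IsUniformIntegral f a) {c : H →L[ℂ] H}
    (hc : c ∈ Set.centralizer P.operators) : c ∈ Set.centralizer {a} := by
  have hcl : IsClosed {T : H →L[ℂ] H | T * c = c * T} := isClosed_eq (by fun_prop) (by fun_prop)
  have hmem : a ∈ closure {T : H →L[ℂ] H | T * c = c * T} := by
    refine Metric.mem_closure_iff.2 fun ε hε => ?_
    obtain ⟨h, -, h2⟩ := hf (ε / 2) (half_pos hε)
    refine ⟨P.stepIntegral h, ?_, ?_⟩
    · refine (Commute.sum_left _ _ _ fun α _ => Commute.smul_left ?_ α).eq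
      exact hc _ ⟨_, h.measurableSet_fiber α, rfl⟩
    · rw [dist_eq_norm]
      exact h2.trans_lt (half_lt_self hε)
  rw [hcl.closure_eq] at hmem
  rintro _ rfl
  exact hmem

end Approx

/-! ### Uniqueness, norm integrals and support for a representation -/

section Representation

variable {H : Type*} [NormedAddCommGroup H] [InnerProductSpace ℂ H] [CompleteSpace H]
  {X : Type*} [TopologicalSpace X] [CompactSpace X] [MeasurableSpace X] [BorelSpace X]

theorem IsNormIntegral.isUniformIntegral {P : SpectralMeasure X H} {f : C(X, ℂ)}
    {a : H →L[ℂ] H} (h : P.IsNormIntegral f a) : P.IsUniformIntegral f a := fun ε hε => by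
  obtain ⟨k, hk⟩ := exists_simpleFunc_norm_sub_le f hε
  exact ⟨k, hk, (h.2.2 k).trans (Real.iSup_le hk hε.le)⟩

variable [T2Space X] [TopologicalSpace.PseudoMetrizableSpace X]

/-- Finite Borel measures on a pseudometrizable space are determined by their integrals of bounded
continuous functions. -/
theorem eq_ofStarAlgHom {P : SpectralMeasure X H} {Φ : C(X, ℂ) →⋆ₐ[ℂ] (H →L[ℂ] H)}
    (h : ∀ g : C(X, ℂ), P.IsUniformIntegral g (Φ g)) : P = ofStarAlgHom Φ := by
  refine ext_scalarMeasure fun x => ?_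
  rw [scalarMeasure_ofStarAlgHom]
  refine ext_of_forall_integral_eq_of_IsFiniteMeasure fun f => ?_
  let f' : C_c(X, ℝ) := ⟨f.toContinuousMap, HasCompactSupport.of_compactSpace _⟩
  have h1 := (h (toComplex f.toContinuousMap)).inner_apply x
    (BoundedContinuousFunction.integrable _
      (BoundedContinuousFunction.mkOfCompact (toComplex f.toContinuousMap)))
  have h2 := RealRMK.integral_rieszMeasure (positiveFunctional Φ x) f'
  refine Eq.trans ?_ h2.symm
  change _ = (⟪x, Φ (toComplex f.toContinuousMap) x⟫_ℂ).re
  rw [h1]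
  simp only [toComplex_apply]
  rw [integral_complex_ofReal, Complex.ofReal_re]
  rfl

theorem isNormIntegral_ofStarAlgHom (Φ : C(X, ℂ) →⋆ₐ[ℂ] (H →L[ℂ] H)) (g : C(X, ℂ)) :
    (ofStarAlgHom Φ).IsNormIntegral g (Φ g) := by
  refine ⟨g.continuous.measurable, (isCompact_range (by fun_prop)).bddAbove, fun h => ?_⟩
  -- Boundedness is needed because the real supremum of an unbounded family is `0` by convention.
  have hb : BddAbove (Set.range fun z => ‖g z - h z‖) := by
    obtain ⟨C, hC⟩ := h.exists_forall_norm_le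
    refine ⟨‖g‖ + C, ?_⟩
    rintro _ ⟨z, rfl⟩
    exact norm_sub_le_of_le (g.norm_coe_le_norm z) (hC z)
  exact norm_sub_stepIntegral_ofStarAlgHom_le Φ g h (Real.iSup_nonneg fun z => norm_nonneg _)
    fun z => le_ciSup hb z

/-- A nonzero Urysohn function `f` vanishing off a `P`-null `U` has `‖Φ f x‖² = ∫ |f|² dμ_x = 0` for
all `x`, against injectivity. -/
theorem ofStarAlgHom_ne_zero {Φ : C(X, ℂ) →⋆ₐ[ℂ] (H →L[ℂ] H)} (hΦ : Injective Φ) {U : Set X}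
    (hU : IsOpen U) (hne : U.Nonempty) : ofStarAlgHom Φ U ≠ 0 := by
  intro h0
  obtain ⟨z₀, hz₀⟩ := hne
  obtain ⟨f, hf0, hf1, -⟩ := exists_continuous_zero_one_of_isClosed hU.isClosed_compl
    (isClosed_singleton (x := z₀)) (Set.disjoint_singleton_right.2 fun h => h hz₀)
  have h1 : Φ (toComplex f) = 0 := by
    ext x
    rw [zero_apply, ← norm_eq_zero, ← sq_eq_zero_iff,
      ← integral_norm_sq_representingMeasure]
    refine integral_eq_zero_of_ae ?_
    have hμ : representingMeasure Φ x U = 0 := by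
      rw [← scalarMeasure_ofStarAlgHom, scalarMeasure_apply _ _ hU.measurableSet, h0]
      simp
    filter_upwards [measure_eq_zero_iff_ae_notMem.1 hμ] with z hz
    simp [hf0 hz]
  have h2 := congrArg (fun g : C(X, ℂ) => g z₀) (hΦ (h1.trans (map_zero Φ).symm))
  simp [hf1 (Set.mem_singleton z₀)] at h2

end Representation

end SpectralMeasure

/-- The resolution of identity of a representation `Φ` of `C(X, ℂ)` on `H`. -/
def ResolutionOfIdentity.ofStarAlgHom {H : Type*} [NormedAddCommGroup H] [InnerProductSpace ℂ H]
    [CompleteSpace H] {X : Type*} [TopologicalSpace X] [CompactSpace X] [T2Space X]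
    [MeasurableSpace X] [BorelSpace X] [TopologicalSpace.PseudoMetrizableSpace X]
    (Φ : C(X, ℂ) →⋆ₐ[ℂ] (H →L[ℂ] H)) : ResolutionOfIdentity X H where
  toSpectralMeasure := SpectralMeasure.ofStarAlgHom Φ
  innerRegular x := by
    rw [SpectralMeasure.scalarMeasure_ofStarAlgHom]
    infer_instance

/-! ### Normal operators and the continuous functional calculus -/

section Normal

variable {H : Type*} [NormedAddCommGroup H] [InnerProductSpace ℂ H] [CompleteSpace H]
  {b : H →L[ℂ] H}

/-- Stone–Weierstrass induction: uniform integrals respect constants, sums, products, conjugation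
and norm limits. -/
theorem SpectralMeasure.IsNormIntegral.isUniformIntegral_cfcHom (hb : IsStarNormal b)
    {P : SpectralMeasure (spectrum ℂ b) H} (h : P.IsNormIntegral (fun z => (z : ℂ)) b)
    (g : C(spectrum ℂ b, ℂ)) : P.IsUniformIntegral g (cfcHom hb g) := by
  have hid : P.IsUniformIntegral (fun z => (z : ℂ)) b :=
    IsNormIntegral.isUniformIntegral (f := .restrict (spectrum ℂ b) (.id ℂ)) h
  induction g using ContinuousMap.induction_on_of_compact with
  | const r =>
    have : cfcHom hb (ContinuousMap.const _ r) = r • (1 : H →L[ℂ] H) :=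
      (AlgHomClass.commutes (cfcHom hb) r).trans (Algebra.algebraMap_eq_smul_one r)
    rw [this]
    exact .const P r
  | id =>
    rw [cfcHom_id hb]
    exact hid
  | star_id =>
    rw [map_star, cfcHom_id hb]
    exact hid.conj
  | add f g hf hg =>
    rw [map_add]
    exact hf.add hg
  | mul f g hf hg =>
    rw [map_mul]
    exact hf.mul hg (K := max ‖f‖ ‖g‖)
      (fun z => (f.norm_coe_le_norm z).trans (le_max_left _ _))
      (fun z => (g.norm_coe_le_norm z).trans (le_max_right _ _))
  | frequently f hf =>
    refine .of_approx fun ε hε => ?_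
    have e1 : ∀ᶠ g in nhds f, g ∈ Metric.closedBall f ε := Metric.closedBall_mem_nhds f hε
    have e2 : ∀ᶠ g in nhds f, cfcHom hb g ∈ Metric.closedBall (cfcHom hb f) ε :=
      (cfcHom_continuous hb).tendsto f (Metric.closedBall_mem_nhds _ hε)
    obtain ⟨g, hg, h1, h2⟩ := (hf.and_eventually (e1.and e2)).exists
    refine ⟨g, _, hg, fun z => ?_, ?_⟩
    · rw [mem_closedBall_iff_norm'] at h1
      exact ((f - g).norm_coe_le_norm z).trans h1
    · exact mem_closedBall_iff_norm'.1 h2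

end Normal

theorem mainTheorem9 {H : Type*} [NormedAddCommGroup H] [InnerProductSpace ℂ H] [CompleteSpace H]
    [Nontrivial H] (b : H →L[ℂ] H) (hb : IsStarNormal b) :
    (∃! P : ResolutionOfIdentity (spectrum ℂ b) H,
      P.toSpectralMeasure.IsNormIntegral (fun z : spectrum ℂ b => (z : ℂ)) b) ∧
    ∀ P : ResolutionOfIdentity (spectrum ℂ b) H,
      P.toSpectralMeasure.IsNormIntegral (fun z : spectrum ℂ b => (z : ℂ)) b →
        Set.centralizer {b} = Set.centralizer P.toSpectralMeasure.operators ∧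
        P.HasSupport Set.univ := by
  have huniq : ∀ P : ResolutionOfIdentity (spectrum ℂ b) H,
      P.toSpectralMeasure.IsNormIntegral (fun z : spectrum ℂ b => (z : ℂ)) b →
        P = .ofStarAlgHom (cfcHom hb) := fun P hP =>
    ResolutionOfIdentity.ext (congrArg SpectralMeasure.toFun
      (SpectralMeasure.eq_ofStarAlgHom (hP.isUniformIntegral_cfcHom hb)))
  refine ⟨⟨.ofStarAlgHom (cfcHom hb), ?_, huniq⟩, fun P hP => ⟨?_, ?_⟩⟩
  · have := SpectralMeasure.isNormIntegral_ofStarAlgHom (cfcHom hb)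
      (.restrict (spectrum ℂ b) (.id ℂ))
    rwa [cfcHom_id hb] at this
  · refine Set.Subset.antisymm (fun c hc => ?_) fun c hc => ?_
    · have h1 : Commute b c := hc b rfl
      rw [huniq P hP]
      rintro _ ⟨ω, hω, rfl⟩
      -- By Fuglede's theorem (`commute_star_left`), `c` also commutes with `star b`, hence with
      -- every `cfcHom hb g`.
      refine Eq.trans ?_ ((SpectralMeasure.commute_proj (cfcHom hb) hω fun g =>
        h1.cfcHom hb (hb.commute_star_left h1) g).eq.trans ?_)
      all_goals rw [← SpectralMeasure.ofStarAlgHom_apply]; rfl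
    · have := hP.isUniformIntegral_cfcHom hb (.restrict (spectrum ℂ b) (.id ℂ))
      rw [cfcHom_id hb] at this
      exact this.mem_centralizer hc
  · rw [huniq P hP]
    refine ⟨∅, ⟨⟨isOpen_empty, SpectralMeasure.empty _⟩, fun U hU => ?_⟩, Set.compl_empty.symm⟩
    by_contra hne
    exact SpectralMeasure.ofStarAlgHom_ne_zero (cfcHom_injective hb) hU.1
      (Set.nonempty_iff_ne_empty.2 fun h => hne h.le) hU.2

end
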